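/- Let $X$ be a real linear space with a nondegenerate symplectic (i.e. alternating bilinear) form $B$. Let $\Delta(X,B)$ be the $*$-algebra with linear basis $\{\delta_f\mid f\in X\}$, product $\delta_f\delta_h=e^{\frac i2B(f,h)}\delta_{f+h}$, involution $\delta_f^*=\delta_{-f}$ and unit $\delta_0=\mathbb 1$, and let $\mathcal F=\overline{\Delta(X,B)}$ be the CCR algebra, i.e. the enveloping C*-algebra, the completion in the norm $\|A\|=\sup_\omega\sqrt{\omega(A^*A)}$ over all states $\omega$. For a subspace $s\subseteq X$ put $s'=\{f\in X\mid B(f,k)=0\ \forall k\in s\}$ and $\delta_s=\{\delta_f\mid f\in s\}$. Assume $s\subseteq s'$ (i.e. the constraints are first class) and $s=s''$. Consider the constraint set $\mathcal C=\delta_s-\mathbb 1$ in $\mathcal F$. The Dirac states are the states $\omega$ of $\mathcal F$ with $\pi_\omega(C)\Omega_\omega=0$, i.e. $\omega(C^*C)=0$, for all $C\in\mathcal C$; put $\mathcal N=\bigcap_\omega\{A\in\mathcal F\mid\omega(A^*A)=0\}$ (intersection over the Dirac states), $\mathcal D=\mathcal N\cap\mathcal N^*$, $\mathcal O=\{A\in\mathcal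 F\mid AD-DA\in\mathcal D\ \forall D\in\mathcal D\}$ and $\mathcal R=\mathcal O/\mathcal D$. Write $\mathrm C^*(S)$ for the C*-subalgebra generated by $S$ and $[S]$ for the closed linear span of $S$. Then $$\mathcal O=\mathrm C^*(\delta_{s'}\cup\mathcal D)=[\,\mathrm C^*(\delta_{s'})\cup\mathcal D\,].$$ Moreover, the traditional observable algebra $\mathcal O_c:=\mathcal C'$ (the relative commutant of $\mathcal C$ in $\mathcal F$) equals $\mathrm C^*(\delta_{s'})$, and it gives the same physical algebra as the full procedure: $\mathcal O_c\subseteq\mathcal O$, and the canonical map $\mathcal O_c/(\mathcal D\cap\mathcal O_c)\to\mathcal O/\mathcal D=\mathcal R$, $A+(\mathcal D\cap\mathcal O_c)\mapsto A+\mathcal D$, is an isometric $*$-isomorphism. -/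

import Mathlib

/-! ## Presymplectic spaces -/

/-- A (possibly degenerate) symplectic form on a real linear space: an alternating real bilinear
form. -/
structure PresymplecticForm (X : Type*) [AddCommGroup X] [Module ℝ X] where
  /-- the underlying bilinear form -/
  form : LinearMap.BilinForm ℝ X
  isAlt : form.IsAlt

namespace PresymplecticForm

variable {X : Type*} [AddCommGroup X] [Module ℝ X]

/-- The symplectic commutant `s' = {f | B(f, k) = 0 for all k ∈ s}`. -/
def commutant (B : PresymplecticForm X) (s : Submodule ℝ X) : Submodule ℝ X where
  carrier := {f | ∀ k ∈ s, B.form f k = 0}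
  add_mem' := by
    intro a b ha hb k hk
    simp [ha k hk, hb k hk]
  zero_mem' := by
    intro k _
    simp
  smul_mem' := by
    intro c a ha k hk
    simp [ha k hk]

/-- The Weyl cocycle `exp((i/2) B(f, h))`. -/
noncomputable def cocycle (B : PresymplecticForm X) (f h : X) : ℂ :=
  Complex.exp (Complex.I / 2 * (B.form f h : ℂ))

theorem cocycle_zero_left (B : PresymplecticForm X) (f : X) : B.cocycle 0 f = 1 := by
  simp [cocycle]

theorem cocycle_zero_right (B : PresymplecticForm X) (f : X) : B.cocycle f 0 = 1 := by
  simp [cocycle]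

theorem cocycle_assoc (B : PresymplecticForm X) (f g h : X) :
    B.cocycle f g * B.cocycle (f + g) h = B.cocycle g h * B.cocycle f (g + h) := by
  simp only [cocycle, ← Complex.exp_add]
  congr 1
  simp only [map_add, LinearMap.add_apply]
  push_cast
  ring

theorem form_swap (B : PresymplecticForm X) (f h : X) : B.form h f = - B.form f h :=
  (B.isAlt.neg_eq f h).symm

theorem cocycle_star (B : PresymplecticForm X) (f h : X) :
    star (B.cocycle f h) = B.cocycle (-h) (-f) := by
  rw [cocycle, cocycle, Complex.star_def, ← Complex.exp_conj]
  congr 1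
  simp only [map_mul, map_div₀, Complex.conj_I, Complex.conj_ofReal, map_neg, LinearMap.neg_apply,
    neg_neg, form_swap B f h, map_ofNat]
  push_cast
  ring

theorem cocycle_neg_self (B : PresymplecticForm X) (f : X) : B.cocycle (-f) f = 1 := by
  simp [cocycle, B.isAlt f]

end PresymplecticForm

/-! ## The Weyl *-algebra `Δ(X, B)` -/

/-- The involution on finitely supported functions: the conjugate linear map with
`(δ_f)^* = δ_{-f}`. -/
noncomputable def WeylAlg.starFun {X : Type*} [AddCommGroup X] (a : X →₀ ℂ) : X →₀ ℂ :=
  Finsupp.mapDomain (fun f : X => -f) (Finsupp.mapRange (fun z : ℂ => star z) (star_zero ℂ) a)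

theorem WeylAlg.starFun_single {X : Type*} [AddCommGroup X] (f : X) (x : ℂ) :
    starFun (Finsupp.single f x) = Finsupp.single (-f) (star x) := by
  simp [starFun]

theorem WeylAlg.starFun_zero {X : Type*} [AddCommGroup X] : starFun (0 : X →₀ ℂ) = 0 := by
  simp [starFun]

theorem WeylAlg.starFun_add {X : Type*} [AddCommGroup X] (a b : X →₀ ℂ) :
    starFun (a + b) = starFun a + starFun b := by
  rw [starFun, Finsupp.mapRange_add (by intro x y; exact star_add x y), Finsupp.mapDomain_add]
  rfl

/-- `Δ(X, B)`: the finitely supported complex functions on `X`, with the twisted product and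
involution defined below. -/
def WeylAlg {X : Type*} [AddCommGroup X] [Module ℝ X] (_B : PresymplecticForm X) : Type _ :=
  X →₀ ℂ

namespace WeylAlg

variable {X : Type*} [AddCommGroup X] [Module ℝ X] {B : PresymplecticForm X}

noncomputable instance : AddCommGroup (WeylAlg B) := inferInstanceAs (AddCommGroup (X →₀ ℂ))
noncomputable instance : Module ℂ (WeylAlg B) := inferInstanceAs (Module ℂ (X →₀ ℂ))

/-- The function `x • δ_f`. -/
noncomputable def single (B : PresymplecticForm X) (f : X) (x : ℂ) : WeylAlg B :=
  (Finsupp.single f x : X →₀ ℂ)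

/-- The basis element `δ_f`. -/
noncomputable def delta (B : PresymplecticForm X) (f : X) : WeylAlg B := single B f 1

theorem induction_single {p : WeylAlg B → Prop} (a : WeylAlg B) (h0 : p 0)
    (hadd : ∀ a b, p a → p b → p (a + b)) (hs : ∀ f x, p (single B f x)) : p a :=
  Finsupp.induction_linear (motive := p) a h0 (fun a b => hadd a b) hs

/-- The bilinear product on finitely supported functions determined by
`δ_f δ_h = exp((i/2) B(f, h)) δ_{f+h}`. -/
noncomputable def mulFun (B : PresymplecticForm X) : (X →₀ ℂ) →ₗ[ℂ] (X →₀ ℂ) →ₗ[ℂ] (X →₀ ℂ) :=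
  Finsupp.lsum ℂ fun f : X => LinearMap.toSpanSingleton ℂ ((X →₀ ℂ) →ₗ[ℂ] (X →₀ ℂ))
    (Finsupp.lsum ℂ fun h : X => LinearMap.toSpanSingleton ℂ (X →₀ ℂ)
      (Finsupp.single (f + h) (B.cocycle f h)))

theorem mulFun_single (B : PresymplecticForm X) (f h : X) (x y : ℂ) :
    mulFun B (Finsupp.single f x) (Finsupp.single h y) =
      Finsupp.single (f + h) (x * y * B.cocycle f h) := by
  refine Eq.trans (b := x • y • (Finsupp.single (f + h) (B.cocycle f h) : X →₀ ℂ)) ?_ ?_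
  · rw [mulFun, Finsupp.lsum_single, LinearMap.toSpanSingleton_apply, LinearMap.smul_apply,
      Finsupp.lsum_single, LinearMap.toSpanSingleton_apply]
  · rw [Finsupp.smul_single, Finsupp.smul_single, smul_eq_mul, smul_eq_mul, mul_assoc]

/-- The product of `Δ(X, B)` as a bilinear map. -/
noncomputable def mulLin (B : PresymplecticForm X) :
    WeylAlg B →ₗ[ℂ] WeylAlg B →ₗ[ℂ] WeylAlg B := mulFun B

noncomputable instance : Mul (WeylAlg B) := ⟨fun a b => mulLin B a b⟩
noncomputable instance : One (WeylAlg B) := ⟨delta B 0⟩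
noncomputable instance : Star (WeylAlg B) := ⟨fun a => (starFun (a : X →₀ ℂ) : X →₀ ℂ)⟩

theorem mul_def (a b : WeylAlg B) : a * b = mulLin B a b := rfl
theorem one_def : (1 : WeylAlg B) = single B 0 1 := rfl

theorem single_mul_single (f h : X) (x y : ℂ) :
    single B f x * single B h y = single B (f + h) (x * y * B.cocycle f h) :=
  mulFun_single B f h x y

theorem star_single (f : X) (x : ℂ) : star (single B f x) = single B (-f) (star x) :=
  starFun_single f x

theorem smul_single (c : ℂ) (f : X) (x : ℂ) : c • single B f x = single B f (c * x) :=
  Finsupp.smul_single c f x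

theorem star_zero_aux : star (0 : WeylAlg B) = 0 := starFun_zero (X := X)

theorem star_add_aux (a b : WeylAlg B) : star (a + b) = star a + star b :=
  starFun_add (X := X) a b

noncomputable instance : Ring (WeylAlg B) :=
  { (inferInstance : AddCommGroup (WeylAlg B)) with
    mul := (· * ·)
    one := 1
    left_distrib := fun a b c => by simp only [mul_def, map_add]
    right_distrib := fun a b c => by simp only [mul_def, map_add, LinearMap.add_apply]
    zero_mul := fun a => by simp only [mul_def, map_zero, LinearMap.zero_apply]
    mul_zero := fun a => by simp only [mul_def, map_zero]
    one_mul := fun a => by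
      induction a using induction_single with
      | h0 => simp only [mul_def, map_zero]
      | hadd a b ha hb => simp only [mul_def, map_add] at *; rw [ha, hb]
      | hs f x => rw [one_def, single_mul_single, B.cocycle_zero_left]; simp
    mul_one := fun a => by
      induction a using induction_single with
      | h0 => simp only [mul_def, map_zero, LinearMap.zero_apply]
      | hadd a b ha hb => simp only [mul_def, map_add, LinearMap.add_apply] at *; rw [ha, hb]
      | hs f x => rw [one_def, single_mul_single, B.cocycle_zero_right]; simp
    mul_assoc := fun a b c => by
      induction a using induction_single with
      | h0 => simp only [mul_def, map_zero, LinearMap.zero_apply]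
      | hadd a a' ha hb => simp only [mul_def, map_add, LinearMap.add_apply] at *; rw [ha, hb]
      | hs f x =>
        induction b using induction_single with
        | h0 => simp only [mul_def, map_zero, LinearMap.zero_apply]
        | hadd a a' ha hb => simp only [mul_def, map_add, LinearMap.add_apply] at *; rw [ha, hb]
        | hs g y =>
          induction c using induction_single with
          | h0 => simp only [mul_def, map_zero]
          | hadd a a' ha hb => simp only [mul_def, map_add] at *; rw [ha, hb]
          | hs h z =>
            simp only [single_mul_single, add_assoc]
            congr 1
            linear_combination (x * y * z) * B.cocycle_assoc f g h }

noncomputable instance : Algebra ℂ (WeylAlg B) :=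
  Algebra.ofModule
    (fun r a b => by simp only [mul_def, map_smul, LinearMap.smul_apply])
    (fun r a b => by simp only [mul_def, map_smul])

noncomputable instance : StarRing (WeylAlg B) where
  star_involutive a := by
    induction a using induction_single with
    | h0 => rw [star_zero_aux, star_zero_aux]
    | hadd a b ha hb => rw [star_add_aux, star_add_aux, ha, hb]
    | hs f x => rw [star_single, star_single]; simp
  star_add := star_add_aux
  star_mul a b := by
    induction a using induction_single with
    | h0 => rw [zero_mul, star_zero_aux, mul_zero]
    | hadd a a' ha hb => rw [add_mul, star_add_aux, star_add_aux, ha, hb, mul_add]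
    | hs f x =>
      induction b using induction_single with
      | h0 => rw [mul_zero, star_zero_aux, zero_mul]
      | hadd a a' ha hb => rw [mul_add, star_add_aux, star_add_aux, ha, hb, add_mul]
      | hs h y =>
        simp only [single_mul_single, star_single, star_mul, B.cocycle_star, neg_add_rev]
        congr 1
        ring

instance : StarModule ℂ (WeylAlg B) where
  star_smul c a := by
    induction a using induction_single with
    | h0 => rw [smul_zero, star_zero_aux, smul_zero]
    | hadd a b ha hb => rw [smul_add, star_add_aux, ha, hb, star_add_aux, smul_add]
    | hs f x => simp only [smul_single, star_single, star_mul, mul_comm]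

end WeylAlg

/-! ## States -/

open scoped ComplexOrder in
/-- A state on a unital complex *-algebra: a linear functional that is positive and normalised.
On a unital C*-algebra, or a unital Banach *-algebra with isometric involution, these are
automatically continuous of norm one, so they are the states in the usual sense. -/
structure StarState (A : Type*) [Ring A] [StarRing A] [Algebra ℂ A] [StarModule ℂ A] where
  /-- the underlying linear functional -/
  toFun : A →ₗ[ℂ] ℂ
  nonneg : ∀ a, 0 ≤ toFun (star a * a)
  map_one : toFun 1 = 1

namespace StarState

variable {A : Type*} [Ring A] [StarRing A] [Algebra ℂ A] [StarModule ℂ A]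

theorem re_nonneg (ω : StarState A) (a : A) : 0 ≤ (ω.toFun (star a * a)).re :=
  (Complex.nonneg_iff.mp (ω.nonneg a)).1

theorem im_zero (ω : StarState A) (a : A) : (ω.toFun (star a * a)).im = 0 :=
  (Complex.nonneg_iff.mp (ω.nonneg a)).2.symm

theorem map_star_mul (ω : StarState A) (a b : A) :
    ω.toFun (star a * b) = star (ω.toFun (star b * a)) := by
  have h1 := ω.im_zero (a + b)
  have h2 := ω.im_zero (a + Complex.I • b)
  have ha := ω.im_zero a
  have hb := ω.im_zero b
  simp only [star_add, star_smul, add_mul, mul_add, smul_mul_assoc, mul_smul_comm, map_add,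
    map_smul, smul_eq_mul, Complex.add_im, Complex.star_def, Complex.conj_I, Complex.mul_im,
    Complex.I_re, Complex.I_im, Complex.neg_re, Complex.neg_im, Complex.mul_re] at h1 h2
  apply Complex.ext
  · simp only [Complex.star_def, Complex.conj_re]
    linarith
  · simp only [Complex.star_def, Complex.conj_im]
    linarith

/-- The positive semidefinite form `⟨a, b⟩ = ω(a^* b)` of a state. -/
@[reducible]
noncomputable def core (ω : StarState A) : PreInnerProductSpace.Core ℂ A where
  inner a b := ω.toFun (star a * b)
  conj_inner_symm a b := (ω.map_star_mul a b).symm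
  re_inner_nonneg a := ω.re_nonneg a
  add_left a b c := by simp only [star_add, add_mul, map_add]
  smul_left a b r := by
    simp only [star_smul, smul_mul_assoc, map_smul, smul_eq_mul]
    rfl

/-- The seminorm `a ↦ ω(a^* a)^{1/2}`. -/
noncomputable def seminorm (ω : StarState A) (a : A) : ℝ :=
  √(ω.toFun (star a * a)).re

theorem cauchy_schwarz (ω : StarState A) (a b : A) :
    ‖ω.toFun (star a * b)‖ ≤ ω.seminorm a * ω.seminorm b :=
  letI := ω.core
  InnerProductSpace.Core.norm_inner_le_norm a b

theorem seminorm_add_le (ω : StarState A) (a b : A) :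
    ω.seminorm (a + b) ≤ ω.seminorm a + ω.seminorm b :=
  letI := ω.core
  letI := InnerProductSpace.Core.toSeminormedAddCommGroup (𝕜 := ℂ) (F := A)
  norm_add_le a b

theorem seminorm_smul (ω : StarState A) (c : ℂ) (a : A) :
    ω.seminorm (c • a) = ‖c‖ * ω.seminorm a := by
  unfold seminorm
  have : star (c • a) * (c • a) = ((‖c‖ ^ 2 : ℝ) : ℂ) • (star a * a) := by
    rw [star_smul, smul_mul_assoc, mul_smul_comm, smul_smul]
    congr 1
    rw [Complex.star_def, Complex.conj_mul']
    push_cast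
    rfl
  rw [this, map_smul, smul_eq_mul, Complex.re_ofReal_mul, Real.sqrt_mul (by positivity),
    Real.sqrt_sq (norm_nonneg c)]

theorem seminorm_nonneg (ω : StarState A) (a : A) : 0 ≤ ω.seminorm a := Real.sqrt_nonneg _

theorem seminorm_one (ω : StarState A) : ω.seminorm 1 = 1 := by
  simp [seminorm, ω.map_one]

theorem seminorm_sq (ω : StarState A) (a : A) :
    ω.seminorm a ^ 2 = (ω.toFun (star a * a)).re := Real.sq_sqrt (ω.re_nonneg a)

theorem apply_star_mul_self (ω : StarState A) (a : A) :
    ω.toFun (star a * a) = ((ω.seminorm a ^ 2 : ℝ) : ℂ) := by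
  rw [seminorm_sq]
  exact Complex.ext rfl (by rw [ω.im_zero]; simp)

theorem apply_star_mul_self_eq_zero_iff (ω : StarState A) (a : A) :
    ω.toFun (star a * a) = 0 ↔ ω.seminorm a = 0 := by
  rw [apply_star_mul_self]
  norm_cast
  simp

open scoped ComplexOrder in
/-- The vector state `a ↦ ω(b^* a b) / ω(b^* b)`. -/
noncomputable def conj (ω : StarState A) (b : A) (hb : ω.seminorm b ≠ 0) : StarState A where
  toFun := (((ω.seminorm b ^ 2)⁻¹ : ℝ) : ℂ) •
    (ω.toFun ∘ₗ LinearMap.mulLeft ℂ (star b) ∘ₗ LinearMap.mulRight ℂ b)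
  nonneg a := by
    have h : star b * (star a * a * b) = star (a * b) * (a * b) := by
      simp only [star_mul, mul_assoc]
    simp only [LinearMap.smul_apply, LinearMap.comp_apply, LinearMap.mulLeft_apply,
      LinearMap.mulRight_apply, h, smul_eq_mul]
    exact mul_nonneg (by exact_mod_cast inv_nonneg.mpr (sq_nonneg (ω.seminorm b))) (ω.nonneg _)
  map_one := by
    simp only [LinearMap.smul_apply, LinearMap.comp_apply, LinearMap.mulLeft_apply,
      LinearMap.mulRight_apply, one_mul, smul_eq_mul, apply_star_mul_self]
    rw [← Complex.ofReal_mul, inv_mul_cancel₀ (pow_ne_zero 2 hb), Complex.ofReal_one]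

theorem seminorm_mul_eq (ω : StarState A) (a b : A) (hb : ω.seminorm b ≠ 0) :
    ω.seminorm (a * b) = (ω.conj b hb).seminorm a * ω.seminorm b := by
  have h : star b * (star a * a * b) = star (a * b) * (a * b) := by
    simp only [star_mul, mul_assoc]
  have h2 : (ω.conj b hb).seminorm a ^ 2 = (ω.seminorm b ^ 2)⁻¹ * ω.seminorm (a * b) ^ 2 := by
    rw [seminorm_sq _ a, seminorm_sq _ (a * b), conj]
    simp only [LinearMap.smul_apply, LinearMap.comp_apply, LinearMap.mulLeft_apply,
      LinearMap.mulRight_apply, h, smul_eq_mul, Complex.re_ofReal_mul]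
  have h3 : ω.seminorm (a * b) ^ 2 = ((ω.conj b hb).seminorm a * ω.seminorm b) ^ 2 := by
    rw [mul_pow, h2]
    field_simp
  exact (sq_eq_sq₀ (seminorm_nonneg _ _)
    (mul_nonneg (seminorm_nonneg _ _) (seminorm_nonneg _ _))).mp h3

theorem seminorm_mul_eq_zero (ω : StarState A) (a b : A) (hb : ω.seminorm b = 0) :
    ω.seminorm (a * b) = 0 := by
  have h : star (a * b) * (a * b) = star b * (star a * a * b) := by
    simp only [star_mul, mul_assoc]
  rw [← apply_star_mul_self_eq_zero_iff, h, ← norm_le_zero_iff]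
  refine (ω.cauchy_schwarz _ _).trans ?_
  rw [hb, zero_mul]

end StarState

/-! ## The CCR algebra: the enveloping C*-algebra -/

namespace WeylAlg

variable {X : Type*} [AddCommGroup X] [Module ℝ X] {B : PresymplecticForm X}

/-- The norm `‖∑ α_i δ_{f_i}‖_1 = ∑ |α_i|`. -/
noncomputable def normOne (a : WeylAlg B) : ℝ := Finsupp.sum (a : X →₀ ℂ) fun _ x => ‖x‖

theorem seminorm_single (ω : StarState (WeylAlg B)) (f : X) (x : ℂ) :
    ω.seminorm (single B f x) = ‖x‖ := by
  have h1 : single B f x = x • delta B f := by rw [delta, smul_single, mul_one]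
  have h2 : star (delta B f) * delta B f = 1 := by
    rw [delta, star_single, single_mul_single, B.cocycle_neg_self, one_def]
    simp
  rw [h1, ω.seminorm_smul, StarState.seminorm, h2, ω.map_one]
  simp

theorem seminorm_le_normOne (ω : StarState (WeylAlg B)) (a : WeylAlg B) :
    ω.seminorm a ≤ normOne a := by
  let c : X →₀ ℂ := a
  have key : ∀ t : Finset X, ω.seminorm (∑ f ∈ t, single B f (c f)) ≤ ∑ f ∈ t, ‖c f‖ := by
    classical
    intro t
    induction t using Finset.induction_on with
    | empty => simp [StarState.seminorm]
    | insert f t hf ih =>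
      rw [Finset.sum_insert hf, Finset.sum_insert hf]
      refine (ω.seminorm_add_le _ _).trans ?_
      rw [seminorm_single]
      gcongr
  have h : (∑ f ∈ c.support, single B f (c f)) = a := Finsupp.sum_single c
  have h2 := key c.support
  rwa [h] at h2

/-- Every state on `Δ(X, B)` is bounded by `‖·‖_1`; hence the states on `Δ(X, B)` are exactly the
restrictions of the states on the Banach *-algebra `Δ_1(X, B)`, the completion for `‖·‖_1`. -/
theorem norm_state_le_normOne (ω : StarState (WeylAlg B)) (a : WeylAlg B) :
    ‖ω.toFun a‖ ≤ normOne a := by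
  have h := ω.cauchy_schwarz 1 a
  rw [star_one, one_mul, ω.seminorm_one, one_mul] at h
  exact h.trans (seminorm_le_normOne ω a)

theorem normOne_nonneg (a : WeylAlg B) : 0 ≤ normOne a :=
  Finset.sum_nonneg fun _ _ => norm_nonneg _

/-- The enveloping C*-norm `‖a‖ = sup_ω ω(a^* a)^{1/2}`, the supremum over all states. -/
noncomputable instance : Norm (WeylAlg B) := ⟨fun a => ⨆ ω : StarState (WeylAlg B), ω.seminorm a⟩

theorem norm_def (a : WeylAlg B) : ‖a‖ = ⨆ ω : StarState (WeylAlg B), ω.seminorm a := rfl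

theorem seminorm_le_norm (ω : StarState (WeylAlg B)) (a : WeylAlg B) : ω.seminorm a ≤ ‖a‖ :=
  le_ciSup (f := fun ω : StarState (WeylAlg B) => ω.seminorm a)
    ⟨normOne a, by rintro _ ⟨ω, rfl⟩; exact seminorm_le_normOne ω a⟩ ω

theorem norm_nonneg_aux (a : WeylAlg B) : 0 ≤ ‖a‖ :=
  Real.iSup_nonneg fun ω => ω.seminorm_nonneg a

theorem norm_le_aux {a : WeylAlg B} {c : ℝ} (hc : 0 ≤ c)
    (h : ∀ ω : StarState (WeylAlg B), ω.seminorm a ≤ c) : ‖a‖ ≤ c :=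
  Real.iSup_le h hc

theorem norm_add_le_aux (a b : WeylAlg B) : ‖a + b‖ ≤ ‖a‖ + ‖b‖ :=
  norm_le_aux (add_nonneg (norm_nonneg_aux a) (norm_nonneg_aux b)) fun ω =>
    (ω.seminorm_add_le a b).trans (add_le_add (seminorm_le_norm ω a) (seminorm_le_norm ω b))

theorem norm_smul_le_aux (c : ℂ) (a : WeylAlg B) : ‖c • a‖ ≤ ‖c‖ * ‖a‖ :=
  norm_le_aux (mul_nonneg (norm_nonneg c) (norm_nonneg_aux a)) fun ω => by
    rw [ω.seminorm_smul]
    exact mul_le_mul_of_nonneg_left (seminorm_le_norm ω a) (norm_nonneg c)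

theorem norm_mul_le_aux (a b : WeylAlg B) : ‖a * b‖ ≤ ‖a‖ * ‖b‖ :=
  norm_le_aux (mul_nonneg (norm_nonneg_aux a) (norm_nonneg_aux b)) fun ω => by
    by_cases hb : ω.seminorm b = 0
    · rw [ω.seminorm_mul_eq_zero a b hb]
      exact mul_nonneg (norm_nonneg_aux a) (norm_nonneg_aux b)
    · rw [ω.seminorm_mul_eq a b hb]
      exact mul_le_mul (seminorm_le_norm _ a) (seminorm_le_norm ω b) (ω.seminorm_nonneg b)
        (norm_nonneg_aux a)

theorem norm_sq_le_aux (a : WeylAlg B) : ‖a‖ * ‖a‖ ≤ ‖star a * a‖ := by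
  have h : ‖a‖ ≤ √‖star a * a‖ := by
    refine norm_le_aux (Real.sqrt_nonneg _) fun ω => ?_
    refine Real.sqrt_le_sqrt ((Complex.re_le_norm _).trans ?_)
    have h := ω.cauchy_schwarz 1 (star a * a)
    rw [star_one, one_mul, ω.seminorm_one, one_mul] at h
    exact h.trans (seminorm_le_norm ω _)
  calc ‖a‖ * ‖a‖ ≤ √‖star a * a‖ * √‖star a * a‖ :=
        mul_le_mul h h (norm_nonneg_aux a) (Real.sqrt_nonneg _)
    _ = ‖star a * a‖ := Real.mul_self_sqrt (norm_nonneg_aux _)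

theorem norm_le_star_aux (a : WeylAlg B) : ‖a‖ ≤ ‖star a‖ := by
  by_cases h0 : ‖a‖ = 0
  · rw [h0]
    exact norm_nonneg_aux _
  · have hp : 0 < ‖a‖ := lt_of_le_of_ne (norm_nonneg_aux a) (Ne.symm h0)
    exact le_of_mul_le_mul_right ((norm_sq_le_aux a).trans (norm_mul_le_aux _ _)) hp

theorem norm_star_aux (a : WeylAlg B) : ‖star a‖ = ‖a‖ :=
  le_antisymm (by simpa using norm_le_star_aux (star a)) (norm_le_star_aux a)

noncomputable instance : SeminormedAddCommGroup (WeylAlg B) :=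
  SeminormedAddCommGroup.ofCore (𝕜 := ℂ)
    { norm_nonneg := norm_nonneg_aux
      norm_smul := fun c a => by
        refine le_antisymm (norm_smul_le_aux c a) ?_
        by_cases hc : c = 0
        · subst hc
          simpa using norm_nonneg_aux _
        · have h := norm_smul_le_aux c⁻¹ (c • a)
          rw [smul_smul, inv_mul_cancel₀ hc, one_smul, norm_inv] at h
          rwa [inv_mul_eq_div, le_div_iff₀ (norm_pos_iff.mpr hc), mul_comm] at h
      norm_triangle := norm_add_le_aux }

noncomputable instance : SeminormedRing (WeylAlg B) :=
  { (inferInstance : SeminormedAddCommGroup (WeylAlg B)), (inferInstance : Ring (WeylAlg B)) with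
    norm_mul_le := norm_mul_le_aux }

noncomputable instance : NormedSpace ℂ (WeylAlg B) where
  norm_smul_le := norm_smul_le_aux

instance : NormedStarGroup (WeylAlg B) := ⟨fun a => (norm_star_aux a).le⟩

end WeylAlg

/-- The CCR algebra of `(X, B)`: the enveloping C*-algebra, that is the completion of `Δ(X, B)`
in the enveloping C*-norm. -/
def CCRAlgebra {X : Type*} [AddCommGroup X] [Module ℝ X] (B : PresymplecticForm X) : Type _ :=
  UniformSpace.Completion (WeylAlg B)

namespace CCRAlgebra

open UniformSpace

variable {X : Type*} [AddCommGroup X] [Module ℝ X] {B : PresymplecticForm X}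

noncomputable instance : NormedRing (CCRAlgebra B) :=
  inferInstanceAs (NormedRing (Completion (WeylAlg B)))

instance : CompleteSpace (CCRAlgebra B) :=
  inferInstanceAs (CompleteSpace (Completion (WeylAlg B)))

noncomputable instance : Algebra ℂ (CCRAlgebra B) :=
  inferInstanceAs (Algebra ℂ (Completion (WeylAlg B)))

noncomputable instance : NormedAlgebra ℂ (CCRAlgebra B) where
  norm_smul_le c a := norm_smul_le (α := ℂ) (β := Completion (WeylAlg B)) c a

/-- The canonical map from `Δ(X, B)` to its completion. -/
noncomputable def of (a : WeylAlg B) : CCRAlgebra B := (a : Completion (WeylAlg B))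

/-- The involution, extended by continuity. -/
noncomputable instance : Star (CCRAlgebra B) :=
  ⟨Completion.map (star : WeylAlg B → WeylAlg B)⟩

theorem star_of (a : WeylAlg B) : star (of a) = of (star a) :=
  Completion.map_coe (star_isometry (E := WeylAlg B)).uniformContinuous a

theorem continuous_star_aux : Continuous (star : CCRAlgebra B → CCRAlgebra B) :=
  Completion.continuous_map

theorem of_add (a b : WeylAlg B) : of (a + b) = of a + of b := Completion.coe_add a b
theorem of_mul (a b : WeylAlg B) : of (a * b) = of a * of b := Completion.coe_mul a b
theorem of_smul (c : ℂ) (a : WeylAlg B) : of (c • a) = c • of a := Completion.coe_smul c a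
theorem norm_of (a : WeylAlg B) : ‖of a‖ = ‖a‖ := Completion.norm_coe a

theorem denseRange_of : DenseRange (of : WeylAlg B → CCRAlgebra B) :=
  Completion.denseRange_coe (α := WeylAlg B)

noncomputable instance : StarRing (CCRAlgebra B) where
  star_involutive a := by
    refine denseRange_of.induction_on (p := fun a => star (star a) = a) a
      (isClosed_eq (continuous_star_aux.comp continuous_star_aux) continuous_id) fun a => ?_
    rw [star_of, star_of, star_star]
  star_add a b := by
    refine denseRange_of.induction_on₂ (p := fun a b => star (a + b) = star a + star b)
      (isClosed_eq (continuous_star_aux.comp continuous_add)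
        ((continuous_star_aux.comp continuous_fst).add (continuous_star_aux.comp continuous_snd)))
      (fun a b => ?_) a b
    rw [← of_add, star_of, star_of, star_of, ← of_add, star_add]
  star_mul a b := by
    refine denseRange_of.induction_on₂ (p := fun a b => star (a * b) = star b * star a)
      (isClosed_eq (continuous_star_aux.comp continuous_mul)
        ((continuous_star_aux.comp continuous_snd).mul (continuous_star_aux.comp continuous_fst)))
      (fun a b => ?_) a b
    rw [← of_mul, star_of, star_of, star_of, ← of_mul, star_mul]

instance : StarModule ℂ (CCRAlgebra B) where
  star_smul c a := by
    refine denseRange_of.induction_on (p := fun a => star (c • a) = star c • star a) a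
      (isClosed_eq (continuous_star_aux.comp (continuous_const_smul c))
        (continuous_star_aux.const_smul (star c))) fun a => ?_
    rw [← of_smul, star_of, star_of, ← of_smul, star_smul]

instance : CStarRing (CCRAlgebra B) where
  norm_mul_self_le a := by
    refine denseRange_of.induction_on (p := fun a => ‖a‖ * ‖a‖ ≤ ‖star a * a‖) a
      (isClosed_le (continuous_norm.mul continuous_norm)
        (continuous_star_aux.mul continuous_id).norm) fun a => ?_
    rw [star_of, ← of_mul, norm_of, norm_of]
    exact WeylAlg.norm_sq_le_aux a

noncomputable instance : CStarAlgebra (CCRAlgebra B) where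

/-- The Weyl unitary `δ_f` in the CCR algebra. -/
noncomputable def delta (B : PresymplecticForm X) (f : X) : CCRAlgebra B := of (WeylAlg.delta B f)

/-- The constraint set `C = {δ_f - 1 | f ∈ s}`. -/
def constraints (B : PresymplecticForm X) (s : Submodule ℝ X) : Set (CCRAlgebra B) :=
  (fun f => delta B f - 1) '' (s : Set X)

end CCRAlgebra

/-! ## The T-procedure for a constraint set in a unital C*-algebra -/

/-- `C^*(S)`: the (not necessarily unital) C*-subalgebra generated by a subset. -/
noncomputable def cstarGen {F : Type*} [CStarAlgebra F] (S : Set F) : NonUnitalStarSubalgebra ℂ F :=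
  (NonUnitalStarAlgebra.adjoin ℂ S).topologicalClosure

namespace TProcedure

variable {F : Type*} [CStarAlgebra F]

/-- The Dirac states: the states `ω` with `ω(c^* c) = ‖π_ω(c) Ω_ω‖² = 0` for every constraint
`c`, `(π_ω, Ω_ω)` being the GNS data of `ω`. -/
def diracStates (C : Set F) : Set (StarState F) :=
  {ω | ∀ c ∈ C, ω.toFun (star c * c) = 0}

/-- `N`, the intersection of the left kernels `N_ω = {a | ω(a^* a) = 0}` of all Dirac states. -/
def leftKernel (C : Set F) : Set F :=
  {a | ∀ ω ∈ diracStates C, ω.toFun (star a * a) = 0}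

/-- `D = N ∩ N^*`. -/
def constraintAlgebra (C : Set F) : Set F :=
  {a | a ∈ leftKernel C ∧ star a ∈ leftKernel C}

theorem mem_leftKernel {C : Set F} {a : F} :
    a ∈ leftKernel C ↔ ∀ ω ∈ diracStates C, ω.seminorm a = 0 := by
  simp only [leftKernel, Set.mem_ofPred_eq, StarState.apply_star_mul_self_eq_zero_iff]

theorem leftKernel_zero (C : Set F) : (0 : F) ∈ leftKernel C := by
  intro ω _
  simp

theorem leftKernel_add {C : Set F} {a b : F} (ha : a ∈ leftKernel C) (hb : b ∈ leftKernel C) :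
    a + b ∈ leftKernel C := by
  rw [mem_leftKernel] at *
  intro ω hω
  refine le_antisymm ?_ (ω.seminorm_nonneg _)
  have h := ω.seminorm_add_le a b
  rwa [ha ω hω, hb ω hω, add_zero] at h

theorem leftKernel_mul {C : Set F} (a : F) {b : F} (hb : b ∈ leftKernel C) :
    a * b ∈ leftKernel C := by
  rw [mem_leftKernel] at *
  intro ω hω
  exact ω.seminorm_mul_eq_zero a b (hb ω hω)

theorem leftKernel_neg {C : Set F} {a : F} (ha : a ∈ leftKernel C) : -a ∈ leftKernel C := by
  have h := leftKernel_mul (-1) ha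
  rwa [neg_one_mul] at h

theorem leftKernel_sub {C : Set F} {a b : F} (ha : a ∈ leftKernel C) (hb : b ∈ leftKernel C) :
    a - b ∈ leftKernel C := by
  rw [sub_eq_add_neg]
  exact leftKernel_add ha (leftKernel_neg hb)

theorem constraintAlgebra_add {C : Set F} {a b : F} (ha : a ∈ constraintAlgebra C)
    (hb : b ∈ constraintAlgebra C) : a + b ∈ constraintAlgebra C :=
  ⟨leftKernel_add ha.1 hb.1, by rw [star_add]; exact leftKernel_add ha.2 hb.2⟩

theorem constraintAlgebra_zero (C : Set F) : (0 : F) ∈ constraintAlgebra C :=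
  ⟨leftKernel_zero C, by rw [star_zero]; exact leftKernel_zero C⟩

theorem constraintAlgebra_star {C : Set F} {a : F} (ha : a ∈ constraintAlgebra C) :
    star a ∈ constraintAlgebra C :=
  ⟨ha.2, by rw [star_star]; exact ha.1⟩

theorem constraintAlgebra_neg {C : Set F} {a : F} (ha : a ∈ constraintAlgebra C) :
    -a ∈ constraintAlgebra C :=
  ⟨leftKernel_neg ha.1, by rw [star_neg]; exact leftKernel_neg ha.2⟩

/-- If all commutators of `a` with `D` lie in `D`, then `a D ⊆ D` and `D a ⊆ D`. -/
theorem mul_mem_of_commutator {C : Set F} {a : F}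
    (ha : ∀ d ∈ constraintAlgebra C, a * d - d * a ∈ constraintAlgebra C) {d : F}
    (hd : d ∈ constraintAlgebra C) :
    a * d ∈ constraintAlgebra C ∧ d * a ∈ constraintAlgebra C := by
  have h := ha d hd
  have h1 : a * d ∈ leftKernel C := leftKernel_mul a hd.1
  have h2 : star (d * a) ∈ leftKernel C := by
    rw [star_mul]
    exact leftKernel_mul _ hd.2
  refine ⟨⟨h1, ?_⟩, ⟨?_, h2⟩⟩
  · have h3 := leftKernel_add h.2 h2
    rwa [← star_add, sub_add_cancel] at h3
  · have h3 := leftKernel_sub h1 h.1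
    rwa [sub_sub_cancel] at h3

/-- The observable algebra `O = {a | a d - d a ∈ D for all d ∈ D}`. -/
noncomputable def observables (C : Set F) : StarSubalgebra ℂ F where
  carrier := {a | ∀ d ∈ constraintAlgebra C, a * d - d * a ∈ constraintAlgebra C}
  mul_mem' := by
    intro a b ha hb d hd
    have h1 := (mul_mem_of_commutator ha (mul_mem_of_commutator hb hd).1).1
    have h2 := (mul_mem_of_commutator hb (mul_mem_of_commutator ha hd).2).2
    rw [mul_assoc, ← mul_assoc d, sub_eq_add_neg]
    exact constraintAlgebra_add h1 (constraintAlgebra_neg h2)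
  add_mem' := by
    intro a b ha hb d hd
    have h := constraintAlgebra_add (ha d hd) (hb d hd)
    rwa [sub_add_sub_comm, ← add_mul, ← mul_add] at h
  algebraMap_mem' := by
    intro c d _
    rw [Algebra.commutes, sub_self]
    exact constraintAlgebra_zero C
  star_mem' := by
    intro a ha d hd
    have h := constraintAlgebra_neg
      (constraintAlgebra_star (ha (star d) (constraintAlgebra_star hd)))
    rwa [star_sub, star_mul, star_mul, star_star, neg_sub] at h

/-- The traditional observables: the relative commutant `C'` of the (self-adjoint) constraint
set. -/
noncomputable def traditionalObservables (C : Set F) : StarSubalgebra ℂ F := StarSubalgebra.centralizer ℂ C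

theorem mul_mem_of_commute {C : Set F} {a : F} (ha : ∀ c ∈ C, Commute (star a) c) {d : F}
    (hd : star d ∈ leftKernel C) : star (a * d) ∈ leftKernel C := by
  rw [mem_leftKernel] at *
  intro ω hω
  rw [star_mul]
  by_cases h0 : ω.seminorm (star a) = 0
  · exact ω.seminorm_mul_eq_zero _ _ h0
  · rw [ω.seminorm_mul_eq _ _ h0, hd _ ?_, zero_mul]
    intro c hc
    rw [StarState.apply_star_mul_self_eq_zero_iff]
    have h1 : ω.seminorm (c * star a) = 0 := by
      rw [← (ha c hc).eq]
      exact ω.seminorm_mul_eq_zero _ _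
        ((ω.apply_star_mul_self_eq_zero_iff c).mp (hω c hc))
    rw [ω.seminorm_mul_eq _ _ h0] at h1
    exact (mul_eq_zero.mp h1).resolve_right h0

theorem traditionalObservables_le (C : Set F) : traditionalObservables C ≤ observables C := by
  have key : ∀ a ∈ traditionalObservables C, ∀ d ∈ constraintAlgebra C,
      a * d ∈ constraintAlgebra C := by
    intro a ha d hd
    refine ⟨leftKernel_mul a hd.1, mul_mem_of_commute (fun c hc => ?_) hd.2⟩
    exact ((StarSubalgebra.mem_centralizer_iff ℂ).mp (star_mem ha) c hc).1.symm
  intro a ha d hd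
  have h1 := key a ha d hd
  have h2 := constraintAlgebra_star (key (star a) (star_mem ha) _ (constraintAlgebra_star hd))
  rw [star_mul, star_star, star_star] at h2
  rw [sub_eq_add_neg]
  exact constraintAlgebra_add h1 (constraintAlgebra_neg h2)

/-- For a *-subalgebra `A` of `O`, the two-sided ideal `D ∩ A` of `A`. -/
def physicalIdeal (C : Set F) (A : StarSubalgebra ℂ F) (hA : A ≤ observables C) : Ideal A where
  carrier := {a | (a : F) ∈ constraintAlgebra C}
  add_mem' := fun ha hb => constraintAlgebra_add ha hb
  zero_mem' := constraintAlgebra_zero C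
  smul_mem' := fun a _ hb => (mul_mem_of_commutator (hA a.2) hb).1

instance physicalIdeal_isTwoSided (C : Set F) (A : StarSubalgebra ℂ F) (hA : A ≤ observables C) :
    (physicalIdeal C A hA).IsTwoSided :=
  ⟨fun b ha => (mul_mem_of_commutator (hA b.2) ha).2⟩

/-- The physical algebra `A / (D ∩ A)` of a *-subalgebra `A` of `O`. For `A = O` this is
`R = O / D`. -/
abbrev Physical (C : Set F) (A : StarSubalgebra ℂ F) (hA : A ≤ observables C) : Type _ :=
  A ⧸ physicalIdeal C A hA

/-- The involution of the quotient, `[a]^* = [a^*]`. -/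
instance (C : Set F) (A : StarSubalgebra ℂ F) (hA : A ≤ observables C) :
    Star (Physical C A hA) :=
  ⟨Quotient.map' star (by
    intro a b hab
    rw [Submodule.quotientRel_def] at hab ⊢
    have h := constraintAlgebra_star (C := C) hab
    rw [← star_sub]
    exact h)⟩

end TProcedure

/-! ## Closedness of the constraint algebra and of the observables -/

/-! The proof averages observables over conjugation by the constraint unitaries. For `f ∈ s`,
conjugation by `δ_f` multiplies `δ_h` by `exp(i B(f, h))`. This phase is `1` when `h ∈ s'`. When `h
∉ s'`, rescaling inside `s` gives a `k` with phase `-1`, so the mean of `a` and `δ_k a δ_k^*` kills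
`δ_h`. Composing finitely many such means turns a given finite sum into its restriction to `s'`
(`exists_average_eq_restrict`). Each mean is a contraction, so restriction to `s'` is contractive in
the enveloping norm and extends to a contraction `E`, the `expectation`, on the whole algebra. Its
values lie in `C^*(δ_{s'})` (`expectation_mem`), and it is a pointwise limit of compositions of
means (`exists_average_near_expectation`).

Two facts about these compositions pass to the limit. They fix whatever commutes with the
constraints, hence so does `E`, which gives `C' = C^*(δ_{s'})` (`centralizer_constraints`). And for
`a ∈ O` the difference between `a` and its mean is built from commutators of `a` with constraints,
which lie in `D`. As `D` is norm closed, `a - E a ∈ D` (`sub_expectation_mem`).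

Thus `a = E a + (a - E a)` splits every observable along `C^*(δ_{s'})` and `D`. Both lie in the
closed *-algebra `O`, so both descriptions of `O` follow. Since `‖E a‖ ≤ ‖a‖`, every class of `O /
D` has traditional representatives of no larger norm, which makes the canonical map surjective and
isometric (`exists_physical_equiv`). -/

section States

variable {F : Type*} [CStarAlgebra F]

open scoped ComplexOrder in
/-- States of a unital C*-algebra satisfy `ω(a^* a) ≤ ‖a‖²`. -/
theorem StarState.seminorm_le (ω : StarState F) (a : F) : ω.seminorm a ≤ ‖a‖ := by
  let _ := CStarAlgebra.spectralOrder F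
  have := CStarAlgebra.spectralOrderedRing F
  -- In the spectral order `‖a‖² - a^* a` is positive, hence of the form `b^* b`, and positivity of
  -- `ω` applies to it.
  have h1 := sub_nonneg.mpr (CStarAlgebra.star_mul_le_algebraMap_norm_sq (a := a))
  obtain ⟨b, hb⟩ := CStarAlgebra.nonneg_iff_eq_star_mul_self.mp h1
  have h2 := ω.re_nonneg b
  have h3 : algebraMap ℝ F (‖a‖ ^ 2) = ((‖a‖ ^ 2 : ℝ) : ℂ) • (1 : F) := by
    rw [Algebra.algebraMap_eq_smul_one]
    exact (Complex.coe_smul _ _).symm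
  rw [← hb, map_sub, h3, map_smul, ω.map_one, Complex.sub_re, ← ω.seminorm_sq] at h2
  simp only [smul_eq_mul, mul_one, Complex.ofReal_re] at h2
  exact (sq_le_sq₀ (ω.seminorm_nonneg a) (norm_nonneg a)).mp (by linarith)

theorem StarState.continuous_seminorm (ω : StarState F) : Continuous ω.seminorm := by
  refine (LipschitzWith.of_le_add (f := ω.seminorm) fun a b => ?_).continuous
  have h := ω.seminorm_add_le b (a - b)
  rw [add_sub_cancel] at h
  rw [dist_eq_norm]
  exact h.trans (add_le_add_right (ω.seminorm_le _) _)

end States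

namespace TProcedure

variable {F : Type*} [CStarAlgebra F] {C : Set F}

/-- Closedness is what lets membership in `D` survive the passage from finite averages to their
limit. -/
theorem isClosed_leftKernel : IsClosed (leftKernel C) := by
  have h : leftKernel C = ⋂ ω ∈ diracStates C, {a | ω.seminorm a = 0} := by
    ext a
    simp only [mem_leftKernel, Set.mem_iInter, Set.mem_ofPred_eq]
  rw [h]
  exact isClosed_biInter fun ω _ => isClosed_eq ω.continuous_seminorm continuous_const

theorem isClosed_constraintAlgebra : IsClosed (constraintAlgebra C) :=
  isClosed_leftKernel.inter (isClosed_leftKernel.preimage continuous_star)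

theorem constraintAlgebra_mul {a b : F} (ha : a ∈ constraintAlgebra C)
    (hb : b ∈ constraintAlgebra C) : a * b ∈ constraintAlgebra C :=
  ⟨leftKernel_mul a hb.1, by rw [star_mul]; exact leftKernel_mul _ ha.2⟩

theorem constraintAlgebra_sub {a b : F} (ha : a ∈ constraintAlgebra C)
    (hb : b ∈ constraintAlgebra C) : a - b ∈ constraintAlgebra C := by
  rw [sub_eq_add_neg]
  exact constraintAlgebra_add ha (constraintAlgebra_neg hb)

theorem constraintAlgebra_smul (z : ℂ) {a : F} (ha : a ∈ constraintAlgebra C) :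
    z • a ∈ constraintAlgebra C := by
  refine ⟨?_, ?_⟩
  · rw [← smul_one_mul]
    exact leftKernel_mul _ ha.1
  · rw [star_smul, ← smul_one_mul]
    exact leftKernel_mul _ ha.2

theorem mem_observables {a : F} : a ∈ observables C ↔
    ∀ d ∈ constraintAlgebra C, a * d - d * a ∈ constraintAlgebra C := Iff.rfl

theorem constraintAlgebra_subset_observables : constraintAlgebra C ⊆ observables C :=
  fun _ ha _ hd => constraintAlgebra_sub (constraintAlgebra_mul ha hd) (constraintAlgebra_mul hd ha)

theorem isClosed_observables : IsClosed (observables C : Set F) := by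
  have h : (observables C : Set F) =
      ⋂ d ∈ constraintAlgebra C, {a | a * d - d * a ∈ constraintAlgebra C} := by
    ext a
    simp only [SetLike.mem_coe, mem_observables, Set.mem_iInter, Set.mem_ofPred_eq]
  rw [h]
  exact isClosed_biInter fun d _ => isClosed_constraintAlgebra.preimage
    ((continuous_mul_const d).sub (continuous_const_mul d))

/-- A constraint whose adjoint is also a constraint lies in `D`. -/
theorem constraint_mem {c : F} (hc : c ∈ C) (hc' : star c ∈ C) : c ∈ constraintAlgebra C :=
  ⟨fun _ hω => hω c hc, fun _ hω => hω _ hc'⟩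

/-! ### Comparison of the two physical algebras -/

/-- If every observable is, modulo `D` and without increasing its norm, a traditional observable,
then the canonical map `O_c / (D ∩ O_c) → O / D` is an isometric *-isomorphism. -/
theorem exists_physical_equiv
    (h : ∀ a ∈ observables C, ∃ e ∈ traditionalObservables C,
      a - e ∈ constraintAlgebra C ∧ ‖e‖ ≤ ‖a‖) :
    ∃ Φ : Physical C (traditionalObservables C) (traditionalObservables_le C) ≃⋆ₐ[ℂ]
          Physical C (observables C) le_rfl,
      (∀ a : traditionalObservables C, Φ (Ideal.Quotient.mk _ a) =
        Ideal.Quotient.mk _ (StarSubalgebra.inclusion (traditionalObservables_le C) a)) ∧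
      ∀ x, ‖Φ x‖ = ‖x‖ := by
  let ι := StarSubalgebra.inclusion (traditionalObservables_le C)
  let φ : Physical C (traditionalObservables C) (traditionalObservables_le C) →ₐ[ℂ]
      Physical C (observables C) le_rfl :=
    Ideal.quotientMapₐ _ (ι : traditionalObservables C →ₐ[ℂ] observables C) fun _ ha => ha
  have hφ : ∀ a, φ (Ideal.Quotient.mk _ a) = Ideal.Quotient.mk _ (ι a) := fun a => rfl
  have hstar : ∀ x, φ (star x) = star (φ x) := by
    intro x
    obtain ⟨a, rfl⟩ := Ideal.Quotient.mk_surjective x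
    rfl
  have hinj : Function.Injective φ := by
    rw [injective_iff_map_eq_zero]
    intro x hx
    obtain ⟨a, rfl⟩ := Ideal.Quotient.mk_surjective x
    rw [hφ, Ideal.Quotient.eq_zero_iff_mem] at hx
    exact Ideal.Quotient.eq_zero_iff_mem.mpr hx
  have lift : ∀ a : observables C, ∃ e : traditionalObservables C,
      φ (Ideal.Quotient.mk _ e) = Ideal.Quotient.mk _ a ∧ ‖e‖ ≤ ‖a‖ := by
    intro a
    obtain ⟨e, he, had, hn⟩ := h a a.2
    refine ⟨⟨e, he⟩, ?_, hn⟩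
    rw [hφ, eq_comm, Ideal.Quotient.mk_eq_mk_iff_sub_mem]
    exact had
  have hsurj : Function.Surjective φ := by
    intro y
    obtain ⟨a, rfl⟩ := Ideal.Quotient.mk_surjective y
    obtain ⟨e, he, -⟩ := lift a
    exact ⟨_, he⟩
  -- Both norms are infima over representatives. A representative in `O_c` also represents the
  -- image, giving `≤`; `lift` replaces a nearly optimal one in `O` by a traditional one of no
  -- larger norm, giving `≥`.
  have hnorm : ∀ x, ‖φ x‖ = ‖x‖ := by
    intro x
    refine le_antisymm (le_of_forall_pos_le_add fun ε hε => ?_)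
      (le_of_forall_pos_le_add fun ε hε => ?_)
    · obtain ⟨a, rfl, ha⟩ := Submodule.Quotient.norm_mk_lt x hε
      exact (Submodule.Quotient.norm_mk_le _ (ι a)).trans ha.le
    · obtain ⟨a, hax, ha⟩ := Submodule.Quotient.norm_mk_lt (φ x) hε
      obtain ⟨e, he, hn⟩ := lift a
      obtain rfl : Ideal.Quotient.mk _ e = x := hinj (he.trans hax)
      exact ((Submodule.Quotient.norm_mk_le _ e).trans hn).trans ha.le
  let e := RingEquiv.ofBijective φ ⟨hinj, hsurj⟩
  exact ⟨{ e with map_star' := hstar, map_smul' := fun r x => map_smul φ r x }, hφ, hnorm⟩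

end TProcedure

/-! ## Averaging over the constraint unitaries -/

namespace PresymplecticForm

variable {X : Type*} [AddCommGroup X] [Module ℝ X] {B : PresymplecticForm X}

theorem mem_commutant {s : Submodule ℝ X} {f : X} :
    f ∈ B.commutant s ↔ ∀ k ∈ s, B.form f k = 0 := Iff.rfl

/-- If `h ∉ s'`, some `k ∈ s` has `B(k, h) = π`. -/
theorem exists_form_eq_pi {s : Submodule ℝ X} {h : X} (hh : h ∉ B.commutant s) :
    ∃ k ∈ s, B.form k h = Real.pi := by
  rw [mem_commutant] at hh
  push Not at hh
  obtain ⟨k, hk, hne⟩ := hh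
  have hne' : B.form k h ≠ 0 := by
    rw [B.form_swap]
    exact neg_ne_zero.mpr hne
  -- `s` is a real subspace, so the nonzero value `B(k, h)` can be rescaled to `π`.
  refine ⟨(Real.pi / B.form k h) • k, s.smul_mem _ hk, ?_⟩
  rw [map_smul, LinearMap.smul_apply, smul_eq_mul, div_mul_cancel₀ _ hne']

end PresymplecticForm

namespace CCRAlgebra

variable {X : Type*} [AddCommGroup X] [Module ℝ X] {B : PresymplecticForm X}

/-! ### Weyl relations and conjugation by Weyl unitaries -/

theorem delta_mul_delta (f h : X) :
    delta B f * delta B h = B.cocycle f h • delta B (f + h) := by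
  simp only [delta, ← of_mul, ← of_smul, WeylAlg.delta, WeylAlg.single_mul_single,
    WeylAlg.smul_single, one_mul, mul_one]

theorem star_delta (f : X) : star (delta B f) = delta B (-f) := by
  simp only [delta, star_of, WeylAlg.delta, WeylAlg.star_single, star_one]

theorem delta_zero : delta B 0 = 1 := rfl

theorem delta_neg_mul (f : X) : delta B (-f) * delta B f = 1 := by
  rw [delta_mul_delta, B.cocycle_neg_self, neg_add_cancel, delta_zero, one_smul]

theorem delta_mul_neg (f : X) : delta B f * delta B (-f) = 1 := by
  simpa using delta_neg_mul (B := B) (-f)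

theorem delta_mem_unitary (f : X) : delta B f ∈ unitary (CCRAlgebra B) := by
  rw [Unitary.mem_iff, star_delta]
  exact ⟨delta_neg_mul f, delta_mul_neg f⟩

theorem norm_delta_conj (f : X) (a : CCRAlgebra B) : ‖delta B f * a * delta B (-f)‖ = ‖a‖ := by
  rw [CStarRing.norm_mul_mem_unitary _ (delta_mem_unitary (-f)),
    CStarRing.norm_mem_unitary_mul _ (delta_mem_unitary f)]

/-- Conjugation by `δ_f` multiplies `δ_h` by the phase `exp(i B(f, h))`. -/
theorem delta_conj_delta (f h : X) : delta B f * delta B h * delta B (-f) =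
    Complex.exp (Complex.I * (B.form f h : ℂ)) • delta B h := by
  rw [delta_mul_delta, smul_mul_assoc, delta_mul_delta, smul_smul, add_neg_cancel_comm]
  congr 1
  rw [PresymplecticForm.cocycle, PresymplecticForm.cocycle, ← Complex.exp_add]
  congr 1
  -- The two cocycles thus contribute the same half phase, and together give the full phase `B(f,
  -- h)`.
  have h1 : B.form (f + h) (-f) = B.form f h := by
    rw [map_neg, map_add, LinearMap.add_apply, B.isAlt f, zero_add, B.form_swap f h, neg_neg]
  rw [h1]
  ring

/-! ### Averages and their compositions -/

/-- The average `a ↦ (a + δ_f a δ_f^*) / 2`. -/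
noncomputable def avg (B : PresymplecticForm X) (f : X) : Module.End ℂ (CCRAlgebra B) :=
  (2⁻¹ : ℂ) • (1 + LinearMap.mulLeft ℂ (delta B f) ∘ₗ LinearMap.mulRight ℂ (delta B (-f)))

theorem avg_apply (f : X) (a : CCRAlgebra B) :
    avg B f a = (2⁻¹ : ℂ) • (a + delta B f * a * delta B (-f)) := by
  simp [avg, mul_assoc]

theorem avg_delta (f h : X) : avg B f (delta B h) =
    ((2⁻¹ : ℂ) * (1 + Complex.exp (Complex.I * (B.form f h : ℂ)))) • delta B h := by
  rw [avg_apply, delta_conj_delta, mul_smul, add_smul, one_smul]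

theorem avg_of_commute {f : X} {a : CCRAlgebra B} (h : Commute (delta B f) a) :
    avg B f a = a := by
  rw [avg_apply, h.eq, mul_assoc, delta_mul_neg, mul_one, ← two_smul ℂ a, smul_smul,
    inv_mul_cancel₀ two_ne_zero, one_smul]

theorem norm_avg_le (f : X) (a : CCRAlgebra B) : ‖avg B f a‖ ≤ ‖a‖ := by
  rw [avg_apply, norm_smul]
  have h := norm_add_le a (delta B f * a * delta B (-f))
  rw [norm_delta_conj] at h
  rw [norm_inv, Complex.norm_ofNat]
  linarith

/-- The difference is half of `[a, δ_f] δ_f^*`. Replacing `δ_f` by `δ_f - 1` in the commutator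
changes nothing, and splitting `δ_{-f} = (δ_{-f} - 1) + 1` leaves only constraints and commutators
with constraints. Closure of `D` under sums, scalars and products then suffices for
`sub_average_mem`. -/
theorem sub_avg (f : X) (a : CCRAlgebra B) : a - avg B f a =
    (2⁻¹ : ℂ) • ((a * (delta B f - 1) - (delta B f - 1) * a) * (delta B (-f) - 1) +
      (a * (delta B f - 1) - (delta B f - 1) * a)) := by
  have h : (a * (delta B f - 1) - (delta B f - 1) * a) * (delta B (-f) - 1) +
      (a * (delta B f - 1) - (delta B f - 1) * a) = a - delta B f * a * delta B (-f) := by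
    have h1 : a * delta B f * delta B (-f) = a := by rw [mul_assoc, delta_mul_neg, mul_one]
    calc _ = a * delta B f * delta B (-f) - delta B f * a * delta B (-f) := by noncomm_ring
      _ = _ := by rw [h1]
  rw [h, avg_apply, eq_comm, ← sub_eq_zero]
  module

/-- The compositions of averages over elements of `s`. -/
noncomputable def averages (B : PresymplecticForm X) (s : Submodule ℝ X) :
    Submonoid (Module.End ℂ (CCRAlgebra B)) :=
  Submonoid.closure (avg B '' (s : Set X))

section averages

variable {s : Submodule ℝ X} {T : Module.End ℂ (CCRAlgebra B)}

theorem norm_average_le (hT : T ∈ averages B s) (a : CCRAlgebra B) : ‖T a‖ ≤ ‖a‖ := by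
  induction hT using Submonoid.closure_induction generalizing a with
  | mem T hT =>
    obtain ⟨f, -, rfl⟩ := hT
    exact norm_avg_le f a
  | one => exact le_rfl
  | mul S T _ _ hS hT => exact (hS _).trans (hT a)

theorem average_of_commute (hT : T ∈ averages B s) {a : CCRAlgebra B}
    (ha : ∀ f ∈ s, Commute (delta B f) a) : T a = a := by
  induction hT using Submonoid.closure_induction with
  | mem T hT =>
    obtain ⟨f, hf, rfl⟩ := hT
    exact avg_of_commute (ha f hf)
  | one => rfl
  | mul S T _ _ hS hT => rw [Module.End.mul_apply, hT, hS]

/-- The basis elements are joint eigenvectors of all averages, so a later average still kills the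
`δ_h` it is meant to kill. -/
theorem average_delta (hT : T ∈ averages B s) (h : X) :
    ∃ z : ℂ, T (delta B h) = z • delta B h := by
  induction hT using Submonoid.closure_induction with
  | mem T hT =>
    obtain ⟨f, -, rfl⟩ := hT
    exact ⟨_, avg_delta f h⟩
  | one => exact ⟨1, (one_smul _ _).symm⟩
  | mul S T _ _ hS hT =>
    obtain ⟨z, hz⟩ := hS
    obtain ⟨w, hw⟩ := hT
    exact ⟨w * z, by rw [Module.End.mul_apply, hw, map_smul, hz, smul_smul]⟩

theorem commute_delta {f h : X} (hf : f ∈ s) (hh : h ∈ B.commutant s) :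
    Commute (delta B f) (delta B h) := by
  have h1 : B.form h f = 0 := hh f hf
  have h2 : B.form f h = 0 := by rw [B.form_swap, h1, neg_zero]
  rw [commute_iff_eq, delta_mul_delta, delta_mul_delta, PresymplecticForm.cocycle,
    PresymplecticForm.cocycle, h1, h2, add_comm]

open scoped Classical in
/-- Finitely many `δ_h` with `h ∉ s'` are killed by one composition of averages. -/
theorem exists_average (s : Submodule ℝ X) (t : Finset X) : ∃ T ∈ averages B s, ∀ h ∈ t,
    T (delta B h) = if h ∈ B.commutant s then delta B h else 0 := by
  have fix : ∀ T ∈ averages B s, ∀ h ∈ B.commutant s, T (delta B h) = delta B h :=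
    fun T hT h hh => average_of_commute hT fun f hf => commute_delta hf hh
  induction t using Finset.induction_on with
  | empty => exact ⟨1, one_mem _, by simp⟩
  | insert k t _ ih =>
    obtain ⟨T, hT, hTt⟩ := ih
    by_cases hk : k ∈ B.commutant s
    · refine ⟨T, hT, fun h hh => ?_⟩
      obtain rfl | hh := Finset.mem_insert.mp hh
      · rw [if_pos hk, fix T hT _ hk]
      · exact hTt h hh
    · obtain ⟨f, hf, hfk⟩ := PresymplecticForm.exists_form_eq_pi hk
      have hS : avg B f ∈ averages B s := Submonoid.subset_closure ⟨f, hf, rfl⟩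
      -- The new average acts after `T`: it kills the multiple of `δ_k` left by `T` and respects
      -- what `T` achieved on `t`, fixing `δ_h` for `h ∈ s'` and sending `0` to `0`.
      refine ⟨avg B f * T, mul_mem hS hT, fun h hh => ?_⟩
      obtain rfl | hh := Finset.mem_insert.mp hh
      · obtain ⟨z, hz⟩ := average_delta hT h
        rw [if_neg hk, Module.End.mul_apply, hz, map_smul, avg_delta, hfk, mul_comm Complex.I,
          Complex.exp_pi_mul_I, add_neg_cancel, mul_zero, zero_smul, smul_zero]
      · rw [Module.End.mul_apply, hTt h hh]
        split_ifs with hc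
        · exact fix _ hS h hc
        · exact map_zero _

-- Conjugation by `δ_f` is trivial on observables modulo `D`, because the constraints themselves lie
-- in `D`.
open TProcedure in
theorem sub_average_mem (hT : T ∈ averages B s) {a : CCRAlgebra B}
    (ha : a ∈ observables (constraints B s)) :
    a - T a ∈ constraintAlgebra (constraints B s) := by
  have hc : ∀ f ∈ s, delta B f - 1 ∈ constraintAlgebra (constraints B s) := fun f hf =>
    constraint_mem ⟨f, hf, rfl⟩ ⟨-f, s.neg_mem hf, by rw [star_sub, star_one, star_delta]⟩
  induction hT using Submonoid.closure_induction generalizing a with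
  | mem T hT =>
    obtain ⟨f, hf, rfl⟩ := hT
    rw [sub_avg]
    have h1 := ha _ (hc f hf)
    exact constraintAlgebra_smul _ (constraintAlgebra_add
      (constraintAlgebra_mul h1 (hc (-f) (s.neg_mem hf))) h1)
  | one =>
    rw [Module.End.one_apply, sub_self]
    exact constraintAlgebra_zero _
  | mul S T _ _ hS hT =>
    have h1 := hT ha
    -- The induction step for `S` needs `T a` to be an observable again; it differs from `a` by an
    -- element of `D ⊆ O`.
    have h2 : T a ∈ observables (constraints B s) := by
      have h3 := sub_mem ha (constraintAlgebra_subset_observables h1)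
      rwa [sub_sub_cancel] at h3
    rw [Module.End.mul_apply, ← sub_add_sub_cancel a (T a)]
    exact constraintAlgebra_add h1 (hS h2)

end averages

/-! ## The conditional expectation onto `C^*(δ_{s'})` -/

/-- An element of `Δ(X, B)` as a finitely supported function. -/
def coeff (a : WeylAlg B) : X →₀ ℂ := a

open scoped Classical in
/-- Restriction of a finitely supported function to the subspace `t`. -/
noncomputable def restrict (B : PresymplecticForm X) (t : Submodule ℝ X) (a : WeylAlg B) :
    WeylAlg B :=
  (Finsupp.filter (· ∈ t) (coeff a) : X →₀ ℂ)

theorem restrict_sub (t : Submodule ℝ X) (a b : WeylAlg B) :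
    restrict B t (a - b) = restrict B t a - restrict B t b := by
  classical
  exact Finsupp.filter_sub (fun f => f ∈ t) (coeff a) (coeff b)

theorem restrict_zero (t : Submodule ℝ X) : restrict B t (0 : WeylAlg B) = 0 := by
  classical
  exact Finsupp.filter_zero (fun f => f ∈ t)

theorem of_zero : of (0 : WeylAlg B) = 0 := rfl

theorem of_sum {ι : Type*} (t : Finset ι) (g : ι → WeylAlg B) :
    of (∑ i ∈ t, g i) = ∑ i ∈ t, of (g i) := by
  classical
  induction t using Finset.induction_on with
  | empty => simp [of_zero]
  | insert i t hi ih => rw [Finset.sum_insert hi, Finset.sum_insert hi, of_add, ih]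

theorem of_eq_sum (a : WeylAlg B) :
    of a = ∑ h ∈ (coeff a).support, coeff a h • delta B h := by
  have h : a = ∑ h ∈ (coeff a).support, WeylAlg.single B h (coeff a h) :=
    (Finsupp.sum_single (coeff a)).symm
  refine (congrArg of h).trans ((of_sum _ _).trans (Finset.sum_congr rfl fun h _ => ?_))
  rw [delta, ← of_smul, WeylAlg.delta, WeylAlg.smul_single, mul_one]

open scoped Classical in
theorem of_restrict_eq_sum (t : Submodule ℝ X) (a : WeylAlg B) :
    of (restrict B t a) =
      ∑ h ∈ (coeff a).support, coeff a h • if h ∈ t then delta B h else 0 := by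
  have h : coeff (restrict B t a) = Finsupp.filter (· ∈ t) (coeff a) := rfl
  rw [of_eq_sum, h, Finsupp.support_filter, Finset.sum_filter]
  refine Finset.sum_congr rfl fun h _ => ?_
  split_ifs with hh
  · rw [Finsupp.filter_apply_pos _ _ hh]
  · rw [smul_zero]

/-- The composition of averages depends on the support of `a`, but always inherits the contraction
bound. This is how restriction gets a norm estimate in the enveloping norm. -/
theorem exists_average_eq_restrict (s : Submodule ℝ X) (a : WeylAlg B) :
    ∃ T ∈ averages B s, T (of a) = of (restrict B (B.commutant s) a) := by
  classical
  obtain ⟨T, hT, h⟩ := exists_average (B := B) s (coeff a).support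
  refine ⟨T, hT, ?_⟩
  rw [of_restrict_eq_sum, of_eq_sum, map_sum]
  exact Finset.sum_congr rfl fun k hk => by rw [map_smul, h k hk]

theorem lipschitzWith_restrict (s : Submodule ℝ X) :
    LipschitzWith 1 (restrict B (B.commutant s)) := by
  refine LipschitzWith.of_dist_le_mul fun a b => ?_
  -- The average is chosen for the support of `a - b`, so one operator handles the difference.
  obtain ⟨T, hT, h⟩ := exists_average_eq_restrict s (a - b)
  rw [dist_eq_norm, dist_eq_norm, ← restrict_sub, ← norm_of, ← norm_of (a - b), ← h,
    NNReal.coe_one, one_mul]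
  exact norm_average_le hT _

/-- The conditional expectation of the CCR algebra onto `C^*(δ_{s'})`, the continuous extension of
the restriction to `s'`. -/
noncomputable def expectation (B : PresymplecticForm X) (s : Submodule ℝ X) :
    CCRAlgebra B → CCRAlgebra B :=
  UniformSpace.Completion.map (restrict B (B.commutant s))

theorem expectation_of (s : Submodule ℝ X) (a : WeylAlg B) :
    expectation B s (of a) = of (restrict B (B.commutant s) a) :=
  UniformSpace.Completion.map_coe (lipschitzWith_restrict s).uniformContinuous a

theorem lipschitzWith_expectation (s : Submodule ℝ X) : LipschitzWith 1 (expectation B s) :=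
  (lipschitzWith_restrict s).completion_map

theorem norm_expectation_sub_le (s : Submodule ℝ X) (a b : CCRAlgebra B) :
    ‖expectation B s a - expectation B s b‖ ≤ ‖a - b‖ := by
  rw [← dist_eq_norm, ← dist_eq_norm]
  simpa using (lipschitzWith_expectation s).dist_le_mul a b

theorem norm_expectation_le (s : Submodule ℝ X) (a : CCRAlgebra B) :
    ‖expectation B s a‖ ≤ ‖a‖ := by
  -- Linearity of the extension is not needed: the Lipschitz bound against the fixed point `0`
  -- suffices.
  have h := norm_expectation_sub_le s a 0
  rwa [← of_zero, expectation_of, restrict_zero, of_zero, sub_zero, sub_zero] at h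

/-- The expectation is a pointwise limit of compositions of averages. -/
theorem exists_average_near_expectation (s : Submodule ℝ X) (a : CCRAlgebra B) {ε : ℝ}
    (hε : 0 < ε) : ∃ T ∈ averages B s, ‖expectation B s a - T a‖ < ε := by
  obtain ⟨b, hb⟩ := denseRange_of.exists_dist_lt a (half_pos hε)
  rw [dist_eq_norm] at hb
  -- `T` agrees with the expectation exactly at the approximant `b`, and both maps are contractive,
  -- so at `a` they differ by at most `2‖a - b‖ < ε`.
  obtain ⟨T, hT, h⟩ := exists_average_eq_restrict s b
  refine ⟨T, hT, ?_⟩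
  have h1 := norm_expectation_sub_le s a (of b)
  have h2 := norm_average_le hT (a - of b)
  rw [expectation_of, ← h] at h1
  rw [map_sub] at h2
  calc ‖expectation B s a - T a‖ = ‖(expectation B s a - T (of b)) - (T a - T (of b))‖ := by
        rw [sub_sub_sub_cancel_right]
    _ ≤ _ := norm_sub_le _ _
    _ < ε := by linarith

theorem expectation_of_commute {s : Submodule ℝ X} {a : CCRAlgebra B}
    (ha : ∀ f ∈ s, Commute (delta B f) a) : expectation B s a = a := by
  refine eq_of_norm_sub_le_zero (le_of_forall_pos_le_add fun ε hε => ?_)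
  obtain ⟨T, hT, h⟩ := exists_average_near_expectation s a hε
  rw [average_of_commute hT ha] at h
  rw [zero_add]
  exact h.le

open TProcedure in
theorem sub_expectation_mem {s : Submodule ℝ X} {a : CCRAlgebra B}
    (ha : a ∈ observables (constraints B s)) :
    a - expectation B s a ∈ constraintAlgebra (constraints B s) := by
  rw [← isClosed_constraintAlgebra.closure_eq, Metric.mem_closure_iff]
  intro ε hε
  obtain ⟨T, hT, h⟩ := exists_average_near_expectation s a hε
  refine ⟨a - T a, sub_average_mem hT ha, ?_⟩
  rwa [dist_sub_left, dist_eq_norm]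

/-! ### Generated C*-subalgebras and the range of the expectation -/

theorem subset_cstarGen {F : Type*} [CStarAlgebra F] (S : Set F) : S ⊆ cstarGen S :=
  (NonUnitalStarAlgebra.subset_adjoin ℂ S).trans
    (NonUnitalStarSubalgebra.le_topologicalClosure _)

theorem isClosed_cstarGen {F : Type*} [CStarAlgebra F] (S : Set F) :
    IsClosed (cstarGen S : Set F) :=
  NonUnitalStarSubalgebra.isClosed_topologicalClosure _

theorem cstarGen_mono {F : Type*} [CStarAlgebra F] {S T : Set F} (h : S ⊆ T) :
    cstarGen S ≤ cstarGen T :=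
  NonUnitalStarSubalgebra.topologicalClosure_mono (NonUnitalStarAlgebra.adjoin_mono h)

theorem cstarGen_subset {F : Type*} [CStarAlgebra F] {S : Set F} {A : StarSubalgebra ℂ F}
    (hS : S ⊆ A) (hA : IsClosed (A : Set F)) : (cstarGen S : Set F) ⊆ A :=
  NonUnitalStarSubalgebra.topologicalClosure_minimal _
    (t := A.toNonUnitalStarSubalgebra) (NonUnitalStarAlgebra.adjoin_le hS) hA

theorem expectation_mem (s : Submodule ℝ X) (a : CCRAlgebra B) :
    expectation B s a ∈ cstarGen (delta B '' (B.commutant s : Set X)) := by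
  refine denseRange_of.induction_on
    (p := fun a => expectation B s a ∈ cstarGen (delta B '' (B.commutant s : Set X))) a
    ((isClosed_cstarGen _).preimage (lipschitzWith_expectation s).continuous) fun a => ?_
  rw [expectation_of, of_restrict_eq_sum]
  refine sum_mem fun h _ => SMulMemClass.smul_mem _ ?_
  split_ifs with hh
  · exact subset_cstarGen _ ⟨h, hh, rfl⟩
  · exact zero_mem _

/-! ## The observable algebras of linear constraints -/

open TProcedure

theorem mem_centralizer_constraints {s : Submodule ℝ X} {a : CCRAlgebra B} :
    a ∈ Set.centralizer (constraints B s) ↔ ∀ f ∈ s, Commute (delta B f) a := by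
  rw [Set.mem_centralizer_iff, constraints, Set.forall_mem_image]
  refine forall₂_congr fun f _ => ?_
  rw [sub_mul, mul_sub, one_mul, mul_one, sub_left_inj]
  rfl

/-- The star-subalgebra centralizer commutes with `C` and `C^*`. These sets coincide because `(δ_f -
1)^* = δ_{-f} - 1` and `-f ∈ s`. -/
theorem coe_traditionalObservables (s : Submodule ℝ X) :
    (traditionalObservables (constraints B s) : Set (CCRAlgebra B)) =
      Set.centralizer (constraints B s) := by
  have hstar : star (constraints B s) = constraints B s := by
    have h : star (constraints B s) ⊆ constraints B s := by
      rintro a ⟨f, hf, h⟩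
      refine ⟨-f, s.neg_mem hf, ?_⟩
      have h' : delta B f - 1 = star a := h
      rw [← star_star a, ← h', star_sub, star_one, star_delta]
    exact h.antisymm (by simpa using Set.star_subset_star.mpr h)
  rw [traditionalObservables, StarSubalgebra.coe_centralizer, hstar, Set.union_self]

/-- The expectation fixes the commutant and takes values in `C^*(δ_{s'})`. Conversely the commutant
is a closed *-subalgebra, and it contains `δ_{s'}` because the relevant cocycles are trivial. -/
theorem centralizer_constraints (s : Submodule ℝ X) :
    Set.centralizer (constraints B s) = cstarGen (delta B '' (B.commutant s : Set X)) := by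
  refine subset_antisymm (fun a ha => ?_) ?_
  · rw [← expectation_of_commute (mem_centralizer_constraints.mp ha)]
    exact expectation_mem s a
  · rw [← coe_traditionalObservables]
    refine cstarGen_subset ?_ ?_ <;> rw [coe_traditionalObservables]
    · rintro _ ⟨h, hh, rfl⟩
      exact mem_centralizer_constraints.mpr fun f hf => commute_delta hf hh
    · exact Set.isClosed_centralizer _

theorem cstarGen_subset_observables (s : Submodule ℝ X) :
    (cstarGen (delta B '' (B.commutant s : Set X)) : Set (CCRAlgebra B)) ⊆
      observables (constraints B s) := by
  rw [← centralizer_constraints, ← coe_traditionalObservables]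
  exact traditionalObservables_le _

/-- The splitting `a = E a + (a - E a)` shows that the algebraic span already exhausts `O`, before
any closure. -/
theorem observables_subset_span (s : Submodule ℝ X) :
    (observables (constraints B s) : Set (CCRAlgebra B)) ⊆
      Submodule.span ℂ ((cstarGen (delta B '' (B.commutant s : Set X)) :
        Set (CCRAlgebra B)) ∪ constraintAlgebra (constraints B s)) := by
  intro a ha
  rw [← add_sub_cancel (expectation B s a) a]
  exact add_mem (Submodule.subset_span (Or.inl (expectation_mem s a)))
    (Submodule.subset_span (Or.inr (sub_expectation_mem ha)))

end CCRAlgebra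

open TProcedure CCRAlgebra in
theorem mainTheorem11 {X : Type*} [AddCommGroup X] [Module ℝ X] (B : PresymplecticForm X)
    (hB : B.form.Nondegenerate) (s : Submodule ℝ X) (hs : s ≤ B.commutant s)
    (hss : s = B.commutant (B.commutant s)) :
    -- `O = C^*(δ_{s'} ∪ D)`
    (observables (constraints B s) : Set (CCRAlgebra B)) =
        cstarGen (delta B '' (B.commutant s : Set X) ∪ constraintAlgebra (constraints B s)) ∧
    -- `O = [C^*(δ_{s'}) ∪ D]`, the closed linear span
    (observables (constraints B s) : Set (CCRAlgebra B)) =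
        closure (Submodule.span ℂ ((cstarGen (delta B '' (B.commutant s : Set X)) :
          Set (CCRAlgebra B)) ∪ constraintAlgebra (constraints B s)) : Set (CCRAlgebra B)) ∧
    -- the traditional observables `O_c = C'` are `C^*(δ_{s'})`
    Set.centralizer (constraints B s) = cstarGen (delta B '' (B.commutant s : Set X)) ∧
    (traditionalObservables (constraints B s) : Set (CCRAlgebra B)) =
        Set.centralizer (constraints B s) ∧
    -- the canonical map `O_c / (D ∩ O_c) → O / D` is an isometric *-isomorphism
    ∃ Φ : Physical (constraints B s) (traditionalObservables (constraints B s))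
            (traditionalObservables_le _) ≃⋆ₐ[ℂ]
          Physical (constraints B s) (observables (constraints B s)) le_rfl,
      (∀ a : traditionalObservables (constraints B s),
        Φ (Ideal.Quotient.mk _ a) =
          Ideal.Quotient.mk _ (StarSubalgebra.inclusion (traditionalObservables_le _) a)) ∧
      ∀ x, ‖Φ x‖ = ‖x‖ := by
  have h1 : (observables (constraints B s) : Set (CCRAlgebra B)) ⊆
      cstarGen (delta B '' (B.commutant s : Set X) ∪ constraintAlgebra (constraints B s)) := by
    intro a ha
    rw [← add_sub_cancel (expectation B s a) a]
    refine add_mem ?_ (subset_cstarGen _ (Or.inr (sub_expectation_mem ha)))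
    exact cstarGen_mono Set.subset_union_left (expectation_mem s a)
  have h2 : delta B '' (B.commutant s : Set X) ∪ constraintAlgebra (constraints B s) ⊆
      observables (constraints B s) :=
    Set.union_subset ((subset_cstarGen _).trans (cstarGen_subset_observables s))
      constraintAlgebra_subset_observables
  refine ⟨h1.antisymm (cstarGen_subset h2 isClosed_observables),
    ((observables_subset_span s).trans subset_closure).antisymm (closure_minimal ?_
      isClosed_observables), centralizer_constraints s, coe_traditionalObservables s,
    exists_physical_equiv fun a ha => ⟨expectation B s a, ?_, sub_expectation_mem ha,
      norm_expectation_le s a⟩⟩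
  -- Remaining inclusion for the closed span: `O` is a linear subspace containing both `C^*(δ_{s'})`
  -- and `D`.
  · exact Submodule.span_le (p := Subalgebra.toSubmodule
      (observables (constraints B s)).toSubalgebra).mpr
        (Set.union_subset (cstarGen_subset_observables s) constraintAlgebra_subset_observables)
  · rw [← SetLike.mem_coe, coe_traditionalObservables, centralizer_constraints]
    exact expectation_mem s a
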